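/- All outcome spaces are locally compact second countable Hausdorff spaces with their Borel $\sigma$-algebras, and $\mathcal H$ is a complex separable Hilbert space. An observable $E$ on $\Omega$ with values in $\mathcal H$ is a normalized positive operator valued measure: $E(X)\ge 0$ is a bounded operator on $\mathcal H$ for every Borel set $X\subseteq\Omega$, $E(\Omega)=I$, and $E$ is countably additive in the weak operator topology. It is sharp (a projection valued measure) if $E(X)E(Y)=E(X\cap Y)$ for all Borel sets $X,Y$. For a state $T$ (a positive operator on $\mathcal H$ of trace one), $p^E_T(X)=\operatorname{tr}(T\,E(X))$ denotes the outcome distribution. An observable $E$ on $\Omega_1$ is a fuzzy version of an observable $F$ on $\Omega_2$ if there is a Markov kernel $\mu$ from $\Omega_2$ to $\Omega_1$ (each $\mu_x$ is a Borel probability measure on $\Omega_1$ and $x\mapsto\mu_x(X)$ is measurable for each Borel set $X\subseteq\Omega_1$) such that $$p^E_T(X)=\int_{\Omega_2}\mu_x(X)\,dp^F_T(x)\qquad\text{for all Borel sets }X\subseteq\Omega_1\text{ and all states }T.$$ **Proposition.** Let $P_1$ and $P_2$ be sharp observables on $\Omega_1$ and $\Omega_2$, respectively, with values in the same Hilbert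 space $\mathcal H$. If $P_1$ is a fuzzy version of $P_2$, then there exists a measurable function $\Phi:\Omega_2\to\Omega_1$ such that $P_1=P_2\circ\Phi^{-1}$, that is, $P_1(X)=P_2(\Phi^{-1}(X))$ for every Borel set $X\subseteq\Omega_1$. -/

import Mathlib

open MeasureTheory ProbabilityTheory
open scoped InnerProductSpace

namespace Quantum

section Operators

variable {H : Type*} [NormedAddCommGroup H] [InnerProductSpace ℂ H] [CompleteSpace H]

/-- The index set of a fixed orthonormal (Hilbert) basis of `H`. -/
def stdIndex (H : Type*) [NormedAddCommGroup H] [InnerProductSpace ℂ H] [CompleteSpace H] :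
    Set H :=
  (exists_hilbertBasis ℂ H).choose

/-- A fixed orthonormal (Hilbert) basis of `H`, used to compute traces. -/
noncomputable def stdBasis (H : Type*) [NormedAddCommGroup H] [InnerProductSpace ℂ H]
    [CompleteSpace H] : HilbertBasis (stdIndex H) ℂ H :=
  (exists_hilbertBasis ℂ H).choose_spec.choose

/-- The trace `∑ᵢ ⟪eᵢ, A eᵢ⟫` of an operator. It is only used for positive operators and for
products of a positive trace class operator with a bounded operator; for the former a divergent
series has junk value `0`, which is never confused with trace one. -/
noncomputable def opTrace (A : H →L[ℂ] H) : ℂ :=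
  ∑' i, ⟪stdBasis H i, A (stdBasis H i)⟫_ℂ

/-- States: positive operators of trace one. -/
structure DensityOperator (H : Type*) [NormedAddCommGroup H] [InnerProductSpace ℂ H]
    [CompleteSpace H] where
  /-- The underlying bounded operator. -/
  op : H →L[ℂ] H
  isPositive : op.IsPositive
  trace_eq_one : opTrace op = 1

/-- The positive square root of a state. -/
noncomputable def DensityOperator.sqrt (T : DensityOperator H) : H →L[ℂ] H :=
  CFC.sqrt T.op

lemma DensityOperator.sqrt_isPositive (T : DensityOperator H) : T.sqrt.IsPositive :=
  (ContinuousLinearMap.nonneg_iff_isPositive _).1 (CFC.sqrt_nonneg _)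

lemma DensityOperator.sqrt_sqrt (T : DensityOperator H) (x : H) :
    T.sqrt (T.sqrt x) = T.op x := by
  have h : CFC.sqrt T.op * CFC.sqrt T.op = T.op :=
    CFC.sqrt_mul_sqrt_self _ ((ContinuousLinearMap.nonneg_iff_isPositive _).2 T.isPositive)
  exact congrArg (fun A : H →L[ℂ] H => A x) h

lemma DensityOperator.inner_sqrt (T : DensityOperator H) (x y : H) :
    ⟪T.sqrt x, y⟫_ℂ = ⟪x, T.sqrt y⟫_ℂ :=
  T.sqrt_isPositive.isSymmetric x y

lemma DensityOperator.hasSum_norm_sq (T : DensityOperator H) :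
    HasSum (fun i => ‖T.sqrt (stdBasis H i)‖ ^ 2) 1 := by
  have h1 : Summable fun i => ⟪stdBasis H i, T.op (stdBasis H i)⟫_ℂ := by
    by_contra h
    have := T.trace_eq_one
    rw [opTrace, tsum_eq_zero_of_not_summable h] at this
    exact zero_ne_one this
  have h2 := h1.hasSum
  rw [show (∑' i, ⟪stdBasis H i, T.op (stdBasis H i)⟫_ℂ) = 1 from T.trace_eq_one] at h2
  have h3 := Complex.hasSum_re h2
  convert h3 using 1
  · ext i
    rw [← T.sqrt_sqrt, ← T.inner_sqrt, inner_self_eq_norm_sq_to_K]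
    norm_cast
  · simp

lemma hasSum_norm_inner_sq (x : H) :
    HasSum (fun i => ‖⟪stdBasis H i, x⟫_ℂ‖ ^ 2) (‖x‖ ^ 2) := by
  have h := Complex.hasSum_re ((stdBasis H).hasSum_inner_mul_inner x x)
  rw [inner_self_eq_norm_sq_to_K] at h
  convert h using 1
  · ext i
    rw [← inner_conj_symm x, Complex.conj_mul']
    norm_cast
  · norm_cast

/-- For a state `T` and a bounded operator `A`, the trace of `T A` is the absolutely convergent
sum of the numbers `⟪√T eᵢ, A √T eᵢ⟫`. -/
lemma DensityOperator.hasSum_opTrace (T : DensityOperator H) (A : H →L[ℂ] H) :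
    HasSum (fun i => ⟪T.sqrt (stdBasis H i), A (T.sqrt (stdBasis H i))⟫_ℂ)
      (opTrace (T.op ∘L A)) := by
  have hs := T.hasSum_norm_sq.summable
  let B : H →L[ℂ] H := ContinuousLinearMap.adjoint A
  let f : stdIndex H × stdIndex H → ℂ := fun p =>
    ⟪B (T.sqrt (stdBasis H p.1)), stdBasis H p.2⟫_ℂ *
      ⟪stdBasis H p.2, T.sqrt (stdBasis H p.1)⟫_ℂ
  have hb : ∀ u : stdIndex H → H, Summable (fun i => ‖u i‖ ^ 2) →
      Summable fun p : stdIndex H × stdIndex H => ‖⟪stdBasis H p.2, u p.1⟫_ℂ‖ ^ 2 := by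
    intro u hu
    refine (summable_prod_of_nonneg fun _ => by positivity).2
      ⟨fun i => (hasSum_norm_inner_sq (u i)).summable, ?_⟩
    simpa only [(hasSum_norm_inner_sq _).tsum_eq] using hu
  have hB : Summable fun i => ‖B (T.sqrt (stdBasis H i))‖ ^ 2 := by
    refine Summable.of_nonneg_of_le (fun _ => by positivity) (fun i => ?_)
      (hs.mul_left (‖B‖ ^ 2))
    rw [← mul_pow]
    gcongr
    exact B.le_opNorm _
  have hf : Summable f := by
    refine Summable.of_norm_bounded
      ((hb (fun i => T.sqrt (stdBasis H i)) hs).add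
        (hb (fun i => B (T.sqrt (stdBasis H i))) hB)) fun p => ?_
    rw [norm_mul, norm_inner_symm]
    nlinarith [sq_nonneg (‖⟪stdBasis H p.2, T.sqrt (stdBasis H p.1)⟫_ℂ‖ -
      ‖⟪stdBasis H p.2, B (T.sqrt (stdBasis H p.1))⟫_ℂ‖),
      sq_nonneg ‖⟪stdBasis H p.2, T.sqrt (stdBasis H p.1)⟫_ℂ‖,
      sq_nonneg ‖⟪stdBasis H p.2, B (T.sqrt (stdBasis H p.1))⟫_ℂ‖]
  have h1 := hf.hasSum.prod_fiberwise fun i =>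
    (stdBasis H).hasSum_inner_mul_inner (B (T.sqrt (stdBasis H i))) (T.sqrt (stdBasis H i))
  have h2 := ((Equiv.prodComm _ _).hasSum_iff.2 hf.hasSum).prod_fiberwise
    (g := fun i => ⟪stdBasis H i, T.op (A (stdBasis H i))⟫_ℂ) fun i => by
      have h := (stdBasis H).hasSum_inner_mul_inner (T.sqrt (stdBasis H i))
        (T.sqrt (A (stdBasis H i)))
      rw [T.inner_sqrt, T.sqrt_sqrt] at h
      refine (congrArg (HasSum · _) (funext fun j => ?_)).mp h
      symm
      change ⟪B (T.sqrt (stdBasis H j)), stdBasis H i⟫_ℂ *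
        ⟪stdBasis H i, T.sqrt (stdBasis H j)⟫_ℂ = _
      rw [ContinuousLinearMap.adjoint_inner_left, T.inner_sqrt, T.inner_sqrt (stdBasis H i),
        mul_comm]
  have h3 : opTrace (T.op ∘L A) = ∑' p, f p := h2.tsum_eq
  rw [h3]
  refine (congrArg (HasSum · _) (funext fun i => ?_)).mp h1
  rw [ContinuousLinearMap.adjoint_inner_left]

end Operators

section Observables

open scoped ComplexOrder

variable {Ω : Type*} [MeasurableSpace Ω]
  {H : Type*} [NormedAddCommGroup H] [InnerProductSpace ℂ H] [CompleteSpace H]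

/-- A (normalized) positive operator valued measure on `Ω` with values in `H`: a measure with
values in the bounded operators on `H`, countably additive in the weak operator topology, positive
and with `E Ω = 1`. -/
structure POVM (Ω : Type*) [MeasurableSpace Ω] (H : Type*) [NormedAddCommGroup H]
    [InnerProductSpace ℂ H] [CompleteSpace H] where
  /-- The underlying operator valued measure. -/
  toVectorMeasure : VectorMeasure Ω (H →WOT[ℂ] H)
  isPositive' : ∀ X, MeasurableSet X → (toVectorMeasure X).toCLM.IsPositive
  univ' : (toVectorMeasure Set.univ).toCLM = 1

/-- The bounded operator `E X` that a POVM `E` assigns to a set `X`. -/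
noncomputable def POVM.effect (E : POVM Ω H) (X : Set Ω) : H →L[ℂ] H :=
  (E.toVectorMeasure X).toCLM

/-- A POVM is sharp (a projection valued measure) if it is multiplicative:
`E X * E Y = E (X ∩ Y)`. -/
def POVM.IsSharp (E : POVM Ω H) : Prop :=
  ∀ X Y, MeasurableSet X → MeasurableSet Y → E.effect X * E.effect Y = E.effect (X ∩ Y)

lemma POVM.isPositive (E : POVM Ω H) (X : Set Ω) : (E.effect X).IsPositive := by
  by_cases hX : MeasurableSet X
  · exact E.isPositive' X hX
  · rw [effect, E.toVectorMeasure.not_measurable hX]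
    exact ContinuousLinearMap.isPositive_zero

lemma POVM.hasSum_inner (E : POVM Ω H) {X : ℕ → Set Ω} (hX : ∀ n, MeasurableSet (X n))
    (hd : Pairwise (Function.onFun Disjoint X)) (x y : H) :
    HasSum (fun n => ⟪y, E.effect (X n) x⟫_ℂ) ⟪y, E.effect (⋃ n, X n) x⟫_ℂ := by
  have h := (ContinuousLinearMapWOT.tendsto_iff_forall_inner_apply_tendsto.1
    (E.toVectorMeasure.m_iUnion hX hd)) x y
  refine h.congr fun s => ?_
  induction s using Finset.cons_induction with
  | empty => simp
  | cons a s ha ih =>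
    rw [Finset.sum_cons, Finset.sum_cons, ContinuousLinearMapWOT.add_apply, inner_add_right, ih]
    rfl

lemma POVM.ofReal_opTrace (E : POVM Ω H) (T : DensityOperator H) (X : Set Ω) :
    ENNReal.ofReal (opTrace (T.op ∘L E.effect X)).re =
      ∑' i, ENNReal.ofReal
        (⟪T.sqrt (stdBasis H i), E.effect X (T.sqrt (stdBasis H i))⟫_ℂ).re := by
  have h := Complex.hasSum_re (T.hasSum_opTrace (E.effect X))
  rw [← h.tsum_eq]
  exact ENNReal.ofReal_tsum_of_nonneg
    (fun i => (E.isPositive X).re_inner_nonneg_right _) h.summable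

/-- The distribution `X ↦ tr (T E(X))` of the outcomes of the observable `E` in the state `T`. -/
noncomputable def POVM.outcomeMeasure (E : POVM Ω H) (T : DensityOperator H) : Measure Ω :=
  Measure.ofMeasurable (fun X _ => ENNReal.ofReal (opTrace (T.op ∘L E.effect X)).re)
    (by simp [POVM.effect, opTrace])
    (by
      intro X hX hd
      simp only [E.ofReal_opTrace]
      rw [ENNReal.tsum_comm]
      refine tsum_congr fun i => ?_
      have h := Complex.hasSum_re (E.hasSum_inner hX hd (T.sqrt (stdBasis H i))
        (T.sqrt (stdBasis H i)))
      rw [← h.tsum_eq]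
      exact ENNReal.ofReal_tsum_of_nonneg
        (fun n => (E.isPositive (X n)).re_inner_nonneg_right _) h.summable)

/-- The outcome distribution is given by the trace formula; in particular the trace is a
nonnegative real number. -/
lemma POVM.outcomeMeasure_apply (E : POVM Ω H) (T : DensityOperator H) {X : Set Ω}
    (hX : MeasurableSet X) :
    E.outcomeMeasure T X ≠ ⊤ ∧
      ((E.outcomeMeasure T X).toReal : ℂ) = opTrace (T.op ∘L E.effect X) := by
  have hp := fun i => (E.isPositive X).inner_nonneg_right (T.sqrt (stdBasis H i))
  have h0 : 0 ≤ opTrace (T.op ∘L E.effect X) := (T.hasSum_opTrace (E.effect X)).nonneg hp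
  rw [outcomeMeasure, Measure.ofMeasurable_apply X hX]
  refine ⟨ENNReal.ofReal_ne_top, ?_⟩
  rw [ENNReal.toReal_ofReal (Complex.nonneg_iff.1 h0).1]
  exact Complex.ext rfl (Complex.nonneg_iff.1 h0).2

instance (E : POVM Ω H) (T : DensityOperator H) : IsProbabilityMeasure (E.outcomeMeasure T) := by
  refine ⟨?_⟩
  have h : E.effect Set.univ = 1 := E.univ'
  rw [POVM.outcomeMeasure, Measure.ofMeasurable_apply _ MeasurableSet.univ, h]
  change ENNReal.ofReal (opTrace T.op).re = 1
  simp [T.trace_eq_one]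

/-- `E` is a fuzzy version of `F` if for some Markov kernel `κ` from the outcomes of `F` to the
outcomes of `E` one has `p_T^E(X) = ∫ κ_x(X) dp_T^F(x)` for all measurable `X` and all states
`T`. -/
def POVM.IsFuzzyVersionOf {Ω₁ Ω₂ : Type*} [MeasurableSpace Ω₁] [MeasurableSpace Ω₂]
    (E : POVM Ω₁ H) (F : POVM Ω₂ H) : Prop :=
  ∃ κ : Kernel Ω₂ Ω₁, IsMarkovKernel κ ∧
    ∀ X, MeasurableSet X → ∀ T : DensityOperator H,
      E.outcomeMeasure T X = ∫⁻ x, κ x X ∂(F.outcomeMeasure T)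

end Observables

end Quantum

/-!
Let `κ` smear `F` into `E`, and let `E` be sharp. The set `W` of those `x` for which `κ x` charges
both `X` and `Xᶜ` is `F`-null: in a pure state `φ` with `E X φ = 0`, `κ x X` vanishes almost surely,
so `⟪φ, F W φ⟫ = 0` and hence `F W φ = 0` by positivity; the same holds for the kernel of `E Xᶜ`,
and as `E X` is a projection these two kernels span the space. A countable family of sets `X`
separates the points of `Ω₁`, so outside one common null set every `κ x` takes only the values `0`
and `1` on that family and is therefore a point mass at some `Φ x`. Integrating `κ x X` then gives
`E X = F (Φ ⁻¹' X)`.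
-/

theorem measurable_of_measurable_dirac {α β : Type*} [MeasurableSpace α] [MeasurableSpace β]
    {f : β → α} (hf : Measurable fun x ↦ Measure.dirac (f x)) : Measurable f := by
  intro X hX
  have hfX : f ⁻¹' X = {x | Measure.dirac (f x) X = 1} := by
    ext x
    exact (dirac_eq_one_iff_mem hX).symm
  rw [hfX]
  exact (Measure.measurable_coe hX).comp hf (measurableSet_singleton 1)

theorem exists_countable_forall_exists_eq_dirac_iff (α : Type*) [MeasurableSpace α]
    [MeasurableSpace.CountablySeparated α] :
    ∃ S : Set (Set α), S.Countable ∧ (∀ U ∈ S, MeasurableSet U) ∧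
      ∀ (μ : Measure α) [IsProbabilityMeasure μ],
        (∃ y, μ = Measure.dirac y) ↔ ∀ U ∈ S, μ U = 0 ∨ μ Uᶜ = 0 := by
  obtain ⟨S, hS, hSm, hSsep⟩ := exists_countable_separating α MeasurableSet Set.univ
  refine ⟨S, hS, hSm, fun μ _ ↦ ⟨?_, fun h01 ↦ ?_⟩⟩
  · rintro ⟨y, rfl⟩ U hU
    rw [prob_compl_eq_zero_iff (hSm U hU)]
    exact Measure.dirac_apply_eq_zero_or_one
  · have : HasCountableSeparatingOn α (· ∈ S) Set.univ := ⟨S, hS, fun _ hU ↦ hU, hSsep⟩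
    have : Nonempty α := μ.nonempty_of_neZero
    have : MeasurableSingletonClass α :=
      MeasurableSpace.measurableSingletonClass_of_countablySeparated
    obtain ⟨y, hy⟩ := Filter.exists_singleton_mem_of_forall_separating (l := ae μ) (· ∈ S)
      fun U hU ↦ (h01 U hU).symm.imp id fun hU0 ↦ compl_mem_ae_iff.2 hU0
    refine ⟨y, ?_⟩
    have hμy : μ {y} = 1 := (mem_ae_iff_prob_eq_one (measurableSet_singleton y)).1 hy
    calc
      μ = μ.restrict {y} := (Measure.restrict_eq_self_of_ae_mem hy).symm
      _ = Measure.dirac y := by rw [Measure.restrict_singleton, hμy, one_smul]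

theorem measurableSet_setOf_ne_zero_and_compl_ne_zero {α β : Type*} [MeasurableSpace α]
    [MeasurableSpace β] (κ : Kernel β α) {X : Set α} (hX : MeasurableSet X) :
    MeasurableSet {x | κ x X ≠ 0 ∧ κ x Xᶜ ≠ 0} :=
  (κ.measurable_coe hX (measurableSet_singleton 0)).compl.inter
    (κ.measurable_coe hX.compl (measurableSet_singleton 0)).compl

section DiracKernel

variable {α β : Type*} [MeasurableSpace α] [MeasurableSpace.CountablySeparated α]
  [MeasurableSpace β]

theorem measurableSet_setOf_exists_eq_dirac (κ : Kernel β α) [IsMarkovKernel κ] :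
    MeasurableSet {x | ∃ y, κ x = Measure.dirac y} := by
  obtain ⟨S, hS, hSm, hdirac⟩ := exists_countable_forall_exists_eq_dirac_iff α
  simp only [hdirac, Set.ofPred_forall]
  refine .biInter hS fun U hU ↦ ?_
  exact (κ.measurable_coe (hSm U hU) (measurableSet_singleton 0)).union
    (κ.measurable_coe (hSm U hU).compl (measurableSet_singleton 0))

theorem ae_exists_eq_dirac (κ : Kernel β α) [IsMarkovKernel κ] {ν : Measure β}
    (h01 : ∀ U, MeasurableSet U → ∀ᵐ x ∂ν, κ x U = 0 ∨ κ x Uᶜ = 0) :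
    ∀ᵐ x ∂ν, ∃ y, κ x = Measure.dirac y := by
  obtain ⟨S, hS, hSm, hdirac⟩ := exists_countable_forall_exists_eq_dirac_iff α
  simp only [hdirac]
  exact (ae_ball_iff hS).2 fun U hU ↦ h01 U (hSm U hU)

theorem exists_measurable_forall_eq_dirac (κ : Kernel β α) [IsMarkovKernel κ] :
    ∃ Φ : β → α, Measurable Φ ∧
      ∀ x, (∃ y, κ x = Measure.dirac y) → κ x = Measure.dirac (Φ x) := by
  classical
  obtain _ | ⟨⟨x₀⟩⟩ := isEmpty_or_nonempty β
  · exact ⟨isEmptyElim, measurable_of_empty _, isEmptyElim⟩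
  obtain ⟨y₀⟩ : Nonempty α := (κ x₀).nonempty_of_neZero
  let D : Set β := {x | ∃ y, κ x = Measure.dirac y}
  have hpoint (x : β) : ∃ y, D.piecewise κ (fun _ ↦ Measure.dirac y₀) x = Measure.dirac y := by
    by_cases hx : x ∈ D
    · rw [D.piecewise_eq_of_mem _ _ hx]
      exact hx
    · exact ⟨y₀, D.piecewise_eq_of_notMem _ _ hx⟩
  choose Φ hΦ using hpoint
  refine ⟨Φ, measurable_of_measurable_dirac ?_, fun x hx ↦ ?_⟩
  · simp only [← hΦ]
    exact κ.measurable.piecewise (measurableSet_setOf_exists_eq_dirac κ) measurable_const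
  · rw [← hΦ, D.piecewise_eq_of_mem _ _ hx]

end DiracKernel

namespace Quantum

theorem exists_norm_eq_one_and_eq_smul (𝕜 : Type*) [RCLike 𝕜] {V : Type*} [NormedAddCommGroup V]
    [NormedSpace 𝕜 V] {φ : V} (hφ : φ ≠ 0) : ∃ ψ : V, ‖ψ‖ = 1 ∧ ∃ c : 𝕜, c ≠ 0 ∧ φ = c • ψ := by
  have hc : (‖φ‖ : 𝕜) ≠ 0 := by simpa using hφ
  exact ⟨(‖φ‖ : 𝕜)⁻¹ • φ, norm_smul_inv_norm hφ, ‖φ‖, hc, (smul_inv_smul₀ hc φ).symm⟩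

theorem ext_inner_map_of_norm_eq_one {V : Type*} [NormedAddCommGroup V] [InnerProductSpace ℂ V]
    {A B : V →ₗ[ℂ] V} (h : ∀ ψ : V, ‖ψ‖ = 1 → ⟪A ψ, ψ⟫_ℂ = ⟪B ψ, ψ⟫_ℂ) : A = B := by
  refine (ext_inner_map A B).1 fun φ ↦ ?_
  rcases eq_or_ne φ 0 with rfl | hφ
  · simp only [inner_zero_right]
  · obtain ⟨ψ, hψ, c, -, rfl⟩ := exists_norm_eq_one_and_eq_smul ℂ hφ
    simp only [map_smul, inner_smul_left, inner_smul_right, h ψ hψ]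

section PureStates

variable {H : Type*} [NormedAddCommGroup H] [InnerProductSpace ℂ H] [CompleteSpace H]

theorem apply_eq_zero_iff_inner_eq_zero {A : H →L[ℂ] H} (hA : A.IsPositive) {φ : H} :
    A φ = 0 ↔ ⟪φ, A φ⟫_ℂ = 0 := by
  refine ⟨fun h ↦ by rw [h, inner_zero_right], fun h ↦ ?_⟩
  obtain ⟨B, rfl⟩ := CStarAlgebra.nonneg_iff_eq_star_mul_self.1
    ((ContinuousLinearMap.nonneg_iff_isPositive A).2 hA)
  have hB : B φ = 0 := by
    rwa [mul_apply_eq_comp, ContinuousLinearMap.star_eq_adjoint,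
      ContinuousLinearMap.adjoint_inner_right, inner_self_eq_zero] at h
  rw [mul_apply_eq_comp, hB, map_zero]

theorem opTrace_rankOne_comp (φ ψ : H) (A : H →L[ℂ] H) :
    opTrace (InnerProductSpace.rankOne ℂ φ ψ ∘L A) = ⟪ψ, A φ⟫_ℂ := by
  rw [← ContinuousLinearMap.adjoint_inner_left,
    ← ((stdBasis H).hasSum_inner_mul_inner (ContinuousLinearMap.adjoint A ψ) φ).tsum_eq, opTrace]
  refine tsum_congr fun i ↦ ?_
  rw [ContinuousLinearMap.comp_apply, InnerProductSpace.rankOne_apply, inner_smul_right,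
    ContinuousLinearMap.adjoint_inner_left]

/-- The pure state of a unit vector `φ`, i.e. the orthogonal projection onto the line `ℂ φ`. -/
noncomputable def DensityOperator.pure (φ : H) (hφ : ‖φ‖ = 1) : DensityOperator H where
  op := InnerProductSpace.rankOne ℂ φ φ
  isPositive := InnerProductSpace.isPositive_rankOne_self φ
  trace_eq_one := by
    rw [← ContinuousLinearMap.comp_id (InnerProductSpace.rankOne ℂ φ φ), opTrace_rankOne_comp,
      ContinuousLinearMap.id_apply, inner_self_eq_norm_sq_to_K, hφ]
    simp

end PureStates

namespace POVM

variable {Ω Ω₁ Ω₂ : Type*} [MeasurableSpace Ω] [MeasurableSpace Ω₁] [MeasurableSpace Ω₂]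
  {H : Type*} [NormedAddCommGroup H] [InnerProductSpace ℂ H] [CompleteSpace H]

theorem effect_compl (E : POVM Ω H) {X : Set Ω} (hX : MeasurableSet X) :
    E.effect Xᶜ = 1 - E.effect X := by
  have h := VectorMeasure.of_union (v := E.toVectorMeasure) disjoint_compl_right hX hX.compl
  rw [Set.union_compl_self] at h
  rw [eq_sub_iff_add_eq', ← E.univ', h]
  rfl

theorem IsSharp.isIdempotentElem_effect {E : POVM Ω H} (hE : E.IsSharp) {X : Set Ω}
    (hX : MeasurableSet X) : IsIdempotentElem (E.effect X) := by
  rw [IsIdempotentElem, hE X X hX hX, Set.inter_self]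

theorem outcomeMeasure_pure_toReal (E : POVM Ω H) {X : Set Ω} (hX : MeasurableSet X) {φ : H}
    (hφ : ‖φ‖ = 1) : ((E.outcomeMeasure (.pure φ hφ) X).toReal : ℂ) = ⟪φ, E.effect X φ⟫_ℂ := by
  rw [(E.outcomeMeasure_apply _ hX).2, DensityOperator.pure, opTrace_rankOne_comp]

theorem outcomeMeasure_pure_eq_zero_iff (E : POVM Ω H) {X : Set Ω} (hX : MeasurableSet X) {φ : H}
    (hφ : ‖φ‖ = 1) : E.outcomeMeasure (.pure φ hφ) X = 0 ↔ E.effect X φ = 0 := by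
  rw [apply_eq_zero_iff_inner_eq_zero (E.isPositive X), ← E.outcomeMeasure_pure_toReal hX hφ,
    Complex.ofReal_eq_zero, ENNReal.toReal_eq_zero_iff,
    or_iff_left (E.outcomeMeasure_apply _ hX).1]

theorem outcomeMeasure_eq_zero_of_effect_eq_zero {E : POVM Ω H} {X : Set Ω}
    (hX : MeasurableSet X) (h : E.effect X = 0) (T : DensityOperator H) :
    E.outcomeMeasure T X = 0 := by
  obtain ⟨hfin, htr⟩ := E.outcomeMeasure_apply T hX
  rw [h, ContinuousLinearMap.comp_zero] at htr
  have h0 : opTrace (0 : H →L[ℂ] H) = 0 := by simp [opTrace]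
  rw [h0, Complex.ofReal_eq_zero, ENNReal.toReal_eq_zero_iff] at htr
  exact htr.resolve_right hfin

theorem effect_eq_of_outcomeMeasure_eq {E : POVM Ω₁ H} {F : POVM Ω₂ H} {X : Set Ω₁} {Y : Set Ω₂}
    (hX : MeasurableSet X) (hY : MeasurableSet Y)
    (h : ∀ T, E.outcomeMeasure T X = F.outcomeMeasure T Y) : E.effect X = F.effect Y := by
  refine ContinuousLinearMap.coe_injective (ext_inner_map_of_norm_eq_one fun φ hφ ↦ ?_)
  rw [ContinuousLinearMap.coe_coe, ContinuousLinearMap.coe_coe,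
    (E.isPositive X).inner_left_eq_inner_right, (F.isPositive Y).inner_left_eq_inner_right,
    ← E.outcomeMeasure_pure_toReal hX hφ, h, F.outcomeMeasure_pure_toReal hY hφ]

theorem effect_apply_eq_zero_of_outcomeMeasure_eq_zero_imp {E : POVM Ω₁ H} {F : POVM Ω₂ H}
    {X : Set Ω₁} {Y : Set Ω₂} (hX : MeasurableSet X) (hY : MeasurableSet Y)
    (h : ∀ T, E.outcomeMeasure T X = 0 → F.outcomeMeasure T Y = 0) {φ : H}
    (hφ : E.effect X φ = 0) : F.effect Y φ = 0 := by
  rcases eq_or_ne φ 0 with rfl | hφ0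
  · exact map_zero _
  obtain ⟨ψ, hψ, c, hc, rfl⟩ := exists_norm_eq_one_and_eq_smul ℂ hφ0
  rw [map_smul, smul_eq_zero_iff_right hc] at hφ ⊢
  exact (F.outcomeMeasure_pure_eq_zero_iff hY hψ).1
    (h _ ((E.outcomeMeasure_pure_eq_zero_iff hX hψ).2 hφ))

/-- The kernel `κ` smears the observable `F` into the observable `E`: in every state, the
outcome distribution of `E` is the one of `F` averaged over `κ`.
Thus `E` is a fuzzy version of `F` when some Markov kernel smears `F` into `E`. -/
def IsSmearing (E : POVM Ω₁ H) (F : POVM Ω₂ H) (κ : Kernel Ω₂ Ω₁) : Prop :=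
  ∀ X, MeasurableSet X → ∀ T : DensityOperator H,
    E.outcomeMeasure T X = ∫⁻ x, κ x X ∂(F.outcomeMeasure T)

section Smearing

variable {E : POVM Ω₁ H} {F : POVM Ω₂ H} {κ : Kernel Ω₂ Ω₁}

theorem IsSmearing.ae_eq_zero (h : E.IsSmearing F κ) {X : Set Ω₁} (hX : MeasurableSet X)
    {T : DensityOperator H} (hT : E.outcomeMeasure T X = 0) :
    ∀ᵐ x ∂(F.outcomeMeasure T), κ x X = 0 := by
  rwa [h X hX T, lintegral_eq_zero_iff (κ.measurable_coe hX)] at hT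

theorem IsSmearing.effect_setOf_ne_zero_and_compl_ne_zero (h : E.IsSmearing F κ) {X : Set Ω₁}
    (hX : MeasurableSet X) (hE : IsIdempotentElem (E.effect X)) :
    F.effect {x | κ x X ≠ 0 ∧ κ x Xᶜ ≠ 0} = 0 := by
  have hm := measurableSet_setOf_ne_zero_and_compl_ne_zero κ hX
  have hker {φ : H} (hφ : E.effect X φ = 0) : F.effect {x | κ x X ≠ 0 ∧ κ x Xᶜ ≠ 0} φ = 0 :=
    effect_apply_eq_zero_of_outcomeMeasure_eq_zero_imp hX hm
      (fun T hT ↦ measure_mono_null (fun x hx ↦ hx.1) (h.ae_eq_zero hX hT)) hφ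
  have hker' {φ : H} (hφ : E.effect Xᶜ φ = 0) : F.effect {x | κ x X ≠ 0 ∧ κ x Xᶜ ≠ 0} φ = 0 :=
    effect_apply_eq_zero_of_outcomeMeasure_eq_zero_imp hX.compl hm
      (fun T hT ↦ measure_mono_null (fun x hx ↦ hx.2) (h.ae_eq_zero hX.compl hT)) hφ
  ext φ
  have hrange : E.effect Xᶜ (E.effect X φ) = 0 := by
    rw [E.effect_compl hX, ← mul_apply_eq_comp, hE.one_sub_mul_self, zero_apply]
  have hrange' : E.effect X (E.effect Xᶜ φ) = 0 := by
    rw [E.effect_compl hX, ← mul_apply_eq_comp, hE.mul_one_sub_self, zero_apply]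
  have hφ : φ = E.effect X φ + E.effect Xᶜ φ := by
    rw [E.effect_compl hX, sub_apply, one_apply_eq_self, add_sub_cancel]
  rw [hφ, map_add, hker' hrange, hker hrange', add_zero, zero_apply]

theorem IsSmearing.ae_eq_zero_or_compl_eq_zero (h : E.IsSmearing F κ) {X : Set Ω₁}
    (hX : MeasurableSet X) (hE : IsIdempotentElem (E.effect X)) (T : DensityOperator H) :
    ∀ᵐ x ∂(F.outcomeMeasure T), κ x X = 0 ∨ κ x Xᶜ = 0 := by
  have hnull : F.outcomeMeasure T {x | κ x X ≠ 0 ∧ κ x Xᶜ ≠ 0} = 0 :=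
    outcomeMeasure_eq_zero_of_effect_eq_zero
      (measurableSet_setOf_ne_zero_and_compl_ne_zero κ hX)
      (h.effect_setOf_ne_zero_and_compl_ne_zero hX hE) T
  filter_upwards [measure_eq_zero_iff_ae_notMem.1 hnull] with x hx
  by_contra! hne
  exact hx hne

theorem IsSmearing.effect_eq_preimage (h : E.IsSmearing F κ) {Φ : Ω₂ → Ω₁} (hΦ : Measurable Φ)
    (hκ : ∀ T, ∀ᵐ x ∂(F.outcomeMeasure T), κ x = Measure.dirac (Φ x)) {X : Set Ω₁}
    (hX : MeasurableSet X) : E.effect X = F.effect (Φ ⁻¹' X) := by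
  refine effect_eq_of_outcomeMeasure_eq hX (hΦ hX) fun T ↦ ?_
  calc
    E.outcomeMeasure T X = ∫⁻ x, κ x X ∂(F.outcomeMeasure T) := h X hX T
    _ = ∫⁻ x, (Φ ⁻¹' X).indicator 1 x ∂(F.outcomeMeasure T) := by
      refine lintegral_congr_ae ((hκ T).mono fun x hx ↦ ?_)
      simp only [hx, Measure.dirac_apply' _ hX]
      rfl
    _ = F.outcomeMeasure T (Φ ⁻¹' X) := lintegral_indicator_one (hΦ hX)

end Smearing

end POVM

end Quantum

theorem mainTheorem3_general
    {Ω₁ Ω₂ H : Type*} [MeasurableSpace Ω₁] [MeasurableSpace.CountablySeparated Ω₁]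
    [MeasurableSpace Ω₂] [NormedAddCommGroup H] [InnerProductSpace ℂ H] [CompleteSpace H]
    (E : Quantum.POVM Ω₁ H) (F : Quantum.POVM Ω₂ H) (hE : E.IsSharp)
    (hfuzzy : E.IsFuzzyVersionOf F) :
    ∃ Φ : Ω₂ → Ω₁, Measurable Φ ∧
      ∀ X : Set Ω₁, MeasurableSet X → E.effect X = F.effect (Φ ⁻¹' X) := by
  obtain ⟨κ, _, hκ : E.IsSmearing F κ⟩ := hfuzzy
  obtain ⟨Φ, hΦ, hdirac⟩ := exists_measurable_forall_eq_dirac κ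
  refine ⟨Φ, hΦ, fun X hX ↦ hκ.effect_eq_preimage hΦ (fun T ↦ ?_) hX⟩
  have h01 (U : Set Ω₁) (hU : MeasurableSet U) :
      ∀ᵐ x ∂(F.outcomeMeasure T), κ x U = 0 ∨ κ x Uᶜ = 0 :=
    hκ.ae_eq_zero_or_compl_eq_zero hU (hE.isIdempotentElem_effect hU) T
  exact (ae_exists_eq_dirac κ h01).mono hdirac

theorem mainTheorem3
    {Ω₁ Ω₂ H : Type*}
    [TopologicalSpace Ω₁] [T2Space Ω₁] [LocallyCompactSpace Ω₁] [SecondCountableTopology Ω₁]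
    [MeasurableSpace Ω₁] [BorelSpace Ω₁]
    [TopologicalSpace Ω₂] [T2Space Ω₂] [LocallyCompactSpace Ω₂] [SecondCountableTopology Ω₂]
    [MeasurableSpace Ω₂] [BorelSpace Ω₂]
    [NormedAddCommGroup H] [InnerProductSpace ℂ H] [CompleteSpace H]
    [TopologicalSpace.SeparableSpace H]
    (P₁ : Quantum.POVM Ω₁ H) (P₂ : Quantum.POVM Ω₂ H)
    (hP₁ : P₁.IsSharp) (hP₂ : P₂.IsSharp)
    (hfuzzy : P₁.IsFuzzyVersionOf P₂) :
    ∃ Φ : Ω₂ → Ω₁, Measurable Φ ∧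
      ∀ X : Set Ω₁, MeasurableSet X → P₁.effect X = P₂.effect (Φ ⁻¹' X) :=
  mainTheorem3_general P₁ P₂ hP₁ hfuzzy
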